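/- Let $1\le r\le N\le K$ and $n$ be integers and $\sigma>0$. One observes $n$ independent pairs $(\mathbb M_t,Y_t)$, $t=1,\dots,n$, where $\mathbb M_t=\{(i,j_t(i)):1\le i\le N\}$ is a matching drawn uniformly at random among all matchings of $\{1,\dots,N\}$ into $\{1,\dots,K\}$ (i.e. $j_t$ is a uniformly random injection), and $Y_t\in\mathbb R^N$ has entries $$Y_t^{(i)}=\Theta^{*(i,j_t(i))}+\varepsilon_t^{(i)},\qquad 1\le i\le N,$$ with noises $\varepsilon_t^{(i)}$ that are i.i.d. $N(0,\sigma^2)$ and independent of the matchings. Let $\mathcal C=\{\Theta\in\mathbb R^{N\times K}:\operatorname{rank}(\Theta)=r,\ \max_{i,j}|\Theta^{(i,j)}|\le 1\}$ and define the minimax risk $$\ell=\inf_{\widetilde\Theta}\ \sup_{\Theta^*\in\mathcal C}\ \mathbb E\big[\|\widetilde\Theta-\Theta^*\|_F\big],$$ where the infimum ranges over all estimators, i.e. all (possibly randomized) measurable functions $\widetilde\Theta$ of the data $(\mathbb M_t,Y_t)_{t\le n}$ with values in $\mathbb R^{N\times K}$. Then $\ell=\Omega\big(K\sqrt{r/n}\big)$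 as soon as the number $nN$ of observed entries is at least of order $rK$. Precisely: for every $a>0$ there is a constant $c>0$, depending only on $a$, such that for all such $N,K,r,n,\sigma$ with $nN\ge a\,rK$, $$\ell\ \ge\ c\,\min\{\sigma,1\}\,K\sqrt{\frac rn}.$$ -/

import Mathlib

open MeasureTheory ProbabilityTheory
open scoped ENNReal NNReal

noncomputable section

namespace MatchingCompletion

/-- A one-to-one matching of `N` worker types into `K` job types: every worker type `i` gets a
job type `j(i)`, and distinct worker types get distinct job types. -/
abbrev Matching (N K : ℕ) : Type := Fin N ↪ Fin K

/-- The finite set of matchings carries the discrete σ-algebra. -/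
instance instMeasurableSpaceMatching (N K : ℕ) : MeasurableSpace (Matching N K) := ⊤

/-- The observation operator `Θ ↦ (⟨Xⁱ, Θ⟩)ᵢ` of a matching, where `Xⁱ` is the `N × K` matrix with
entry `1` at `(i, j(i))` and `0` elsewhere, and `⟨·, ·⟩` is the trace inner product. -/
def obsOp {N K : ℕ} (M : Matching N K) (Θ : Matrix (Fin N) (Fin K) ℝ) : Fin N → ℝ :=
  fun i => ∑ k : Fin N, ∑ l : Fin K, Matrix.single i (M i) (1 : ℝ) k l * Θ k l

/-- The uniform distribution on the set of all matchings. -/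
def matchingLaw (N K : ℕ) : Measure (Matching N K) := uniformOn Set.univ

/-- The law of the noise vector of one matching: i.i.d. `N(0, σ²)` coordinates. -/
def noiseLaw (N : ℕ) (σ : ℝ) : Measure (Fin N → ℝ) :=
  Measure.pi fun _ => gaussianReal 0 (Real.toNNReal (σ ^ 2))

/-- One observation: a matching together with the vector of noisy rewards of its `N` pairs. -/
abbrev Obs (N K : ℕ) : Type := Matching N K × (Fin N → ℝ)

/-- The law of one observation `(M, Y)`, `Y = 𝒳_M(Θ) + ε`, where `M` is a uniformly random matching
and `ε` is independent of `M`. -/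
def obsLaw {N K : ℕ} (σ : ℝ) (Θ : Matrix (Fin N) (Fin K) ℝ) : Measure (Obs N K) :=
  ((matchingLaw N K).prod (noiseLaw N σ)).map fun p => (p.1, obsOp p.1 Θ + p.2)

/-- The law of `n` independent observations. -/
def sampleLaw {N K : ℕ} (n : ℕ) (σ : ℝ) (Θ : Matrix (Fin N) (Fin K) ℝ) :
    Measure (Fin n → Obs N K) :=
  Measure.pi fun _ => obsLaw σ Θ

/-- Matrices carry the product σ-algebra of their entries. -/
instance instMeasurableSpaceMatrix (N K : ℕ) : MeasurableSpace (Matrix (Fin N) (Fin K) ℝ) :=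
  inferInstanceAs (MeasurableSpace (Fin N → Fin K → ℝ))

/-- A possibly randomized estimator: a Markov kernel from the data to `N × K` matrices. A measurable
function of the data is the special case of a deterministic kernel. -/
abbrev Estimator (N K n : ℕ) : Type :=
  {κ : Kernel (Fin n → Obs N K) (Matrix (Fin N) (Fin K) ℝ) // IsMarkovKernel κ}

/-- The Frobenius norm. -/
def frobNorm {N K : ℕ} (A : Matrix (Fin N) (Fin K) ℝ) : ℝ :=
  √(∑ i, ∑ j, A i j ^ 2)

/-- The expected Frobenius error `𝔼 ‖Θ̂ - Θ‖_F` of an estimator when the true matrix is `Θ`. -/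
def risk {N K n : ℕ} (σ : ℝ) (est : Estimator N K n) (Θ : Matrix (Fin N) (Fin K) ℝ) : ℝ≥0∞ :=
  ∫⁻ S, ∫⁻ A, ENNReal.ofReal (frobNorm (A - Θ)) ∂(est.1 S) ∂(sampleLaw n σ Θ)

/-- The `N × K` matrices of rank `r` whose entries are bounded by `1` in absolute value. -/
def paramSet (N K r : ℕ) : Set (Matrix (Fin N) (Fin K) ℝ) :=
  {Θ | Θ.rank = r ∧ ∀ i j, |Θ i j| ≤ 1}

/-- The minimax risk in Frobenius norm. -/
def minimaxRisk (N K r n : ℕ) (σ : ℝ) : ℝ≥0∞ :=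
  ⨅ est : Estimator N K n, ⨆ Θ ∈ paramSet N K r, risk σ est Θ

end MatchingCompletion

end

namespace MatchingCompletion

/-! This is Assouad's method over a hypercube of rank-`r` matrices made of `r` blocks of `m = N / r`
equal rows (`hypMatrix`). The block rows form an upper trapezoidal matrix with nonzero diagonal, so
its free entries can be moved by `γ` without changing the rank.

Flipping one bit moves at most `m` entries, all in one column `j`. A matching meets column `j` at
most once, and in the block with probability at most `m / K`. Hence the likelihood ratio of one
observation has second moment at most `1 + (m / K) (exp (γ² / σ²) - 1)`
(`lintegral_exp_sum_matching_le`), and that of the sample the `n`-th power. While this is at most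
`2`, neighbouring hypotheses cannot be told apart (`two_point_bound`), and each of at least `NK / 4`
free entries costs order `γ` on average over the cube. Cauchy–Schwarz turns this into a Frobenius
risk of order `√(NK) γ` (`assouad_bound`). The choice `γ ≍ min(σ, 1) √(rK / (nN))` gives the rate.
-/

/-! ### Product densities and Gaussian likelihood ratios -/

theorem lintegral_pi_prod {ι : Type*} [Fintype ι] {X : ι → Type*} [∀ i, MeasurableSpace (X i)]
    (μ : ∀ i, Measure (X i)) [∀ i, IsProbabilityMeasure (μ i)]
    {f : ∀ i, X i → ℝ≥0∞} (hf : ∀ i, Measurable (f i)) :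
    ∫⁻ x, ∏ i, f i (x i) ∂(Measure.pi μ) = ∏ i, ∫⁻ x, f i x ∂(μ i) := by
  have hind : iIndepFun (fun i (x : ∀ i, X i) => f i (x i)) (Measure.pi μ) :=
    iIndepFun_pi (fun i => (hf i).aemeasurable)
  have h := lintegral_prod_eq_prod_lintegral_of_indepFun Finset.univ
    (fun i (x : ∀ i, X i) => f i (x i)) hind (fun i => (hf i).comp (measurable_pi_apply i))
  rw [h]
  refine Finset.prod_congr rfl fun i _ => ?_
  exact (measurePreserving_eval μ i).lintegral_comp (hf i)

theorem pi_withDensity {ι : Type*} [Fintype ι] {X : ι → Type*} [∀ i, MeasurableSpace (X i)]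
    (μ : ∀ i, Measure (X i)) [∀ i, IsProbabilityMeasure (μ i)]
    {f : ∀ i, X i → ℝ≥0∞} (hf : ∀ i, Measurable (f i))
    [∀ i, SigmaFinite ((μ i).withDensity (f i))] :
    Measure.pi (fun i => (μ i).withDensity (f i)) =
      (Measure.pi μ).withDensity fun x => ∏ i, f i (x i) := by
  refine Measure.pi_eq fun s hs => ?_
  rw [withDensity_apply _ (MeasurableSet.univ_pi hs), ← lintegral_indicator (MeasurableSet.univ_pi hs)]
  have : (Set.univ.pi s).indicator (fun x : ∀ i, X i => ∏ i, f i (x i)) =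
      fun x => ∏ i, (s i).indicator (f i) (x i) := by
    classical
    ext x
    by_cases hx : x ∈ Set.univ.pi s
    · rw [Set.indicator_of_mem hx]
      exact Finset.prod_congr rfl fun i _ => (Set.indicator_of_mem (hx i trivial) _).symm
    · rw [Set.indicator_of_notMem hx]
      simp only [Set.mem_univ_pi, not_forall] at hx
      obtain ⟨i, hi⟩ := hx
      exact (Finset.prod_eq_zero (Finset.mem_univ i) (Set.indicator_of_notMem hi _)).symm
  rw [this, lintegral_pi_prod μ fun i => (hf i).indicator (hs i)]
  refine Finset.prod_congr rfl fun i _ => ?_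
  rw [withDensity_apply _ (hs i), lintegral_indicator (hs i)]

/-- Likelihood ratio of `N(d, v)` against `N(0, v)`. -/
noncomputable def gaussianShift (v : ℝ≥0) (d x : ℝ) : ℝ≥0∞ :=
  ENNReal.ofReal (Real.exp (d / v * x - d ^ 2 / (2 * v)))

theorem measurable_gaussianShift (v : ℝ≥0) (d : ℝ) : Measurable (gaussianShift v d) := by
  unfold gaussianShift; fun_prop

theorem gaussianReal_eq_withDensity_shift {v : ℝ≥0} (hv : v ≠ 0) (d : ℝ) :
    gaussianReal d v = (gaussianReal 0 v).withDensity (gaussianShift v d) := by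
  rw [gaussianReal_of_var_ne_zero _ hv, gaussianReal_of_var_ne_zero _ hv,
    ← withDensity_mul _ (measurable_gaussianPDF _ _) (measurable_gaussianShift v d)]
  congr 1
  ext x
  have hv' : (v : ℝ) ≠ 0 := by exact_mod_cast hv
  simp only [Pi.mul_apply, gaussianPDF, gaussianShift]
  rw [← ENNReal.ofReal_mul (gaussianPDFReal_nonneg _ _ _), gaussianPDFReal, gaussianPDFReal,
    mul_assoc (√_)⁻¹, ← Real.exp_add]
  congr 3
  field_simp
  ring

theorem lintegral_exp_mul_gaussianReal (v : ℝ≥0) (t : ℝ) :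
    ∫⁻ x, ENNReal.ofReal (Real.exp (t * x)) ∂(gaussianReal 0 v) =
      ENNReal.ofReal (Real.exp (v * t ^ 2 / 2)) := by
  rw [← ofReal_integral_eq_lintegral_ofReal (integrable_exp_mul_gaussianReal t)
    (Filter.Eventually.of_forall fun _ => (Real.exp_pos _).le)]
  have := congrFun (mgf_fun_id_gaussianReal (μ := 0) (v := v)) t
  simp only [mgf, zero_mul, zero_add] at this
  rw [this]

/-- This is one plus the χ² divergence. Unlike total variation, it multiplies exactly over
independent coordinates and samples. -/
theorem lintegral_gaussianShift_sq {v : ℝ≥0} (hv : v ≠ 0) (d : ℝ) :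
    ∫⁻ x, gaussianShift v d x ^ 2 ∂(gaussianReal 0 v) =
      ENNReal.ofReal (Real.exp (d ^ 2 / v)) := by
  have hv' : (v : ℝ) ≠ 0 := by exact_mod_cast hv
  have h : ∀ x, gaussianShift v d x ^ 2 = ENNReal.ofReal (Real.exp (-(d ^ 2 / v))) *
      ENNReal.ofReal (Real.exp (2 * d / v * x)) := by
    intro x
    rw [gaussianShift, ← ENNReal.ofReal_pow (Real.exp_pos _).le,
      ← ENNReal.ofReal_mul (Real.exp_pos _).le, ← Real.exp_add, ← Real.exp_nat_mul]
    congr 2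
    push_cast
    field_simp
    ring
  simp_rw [h]
  rw [lintegral_const_mul _ (by fun_prop), lintegral_exp_mul_gaussianReal,
    ← ENNReal.ofReal_mul (Real.exp_pos _).le, ← Real.exp_add]
  congr 2
  field_simp
  ring

/-! ### Le Cam's two-point bound -/

/-- The overlap `∫ min 1 L ∂P` is at least `1 / 2`, and on the overlap both laws charge the total
loss `f + g ≥ s`. -/
theorem two_point_bound {Ω : Type*} [MeasurableSpace Ω] {P Q : Measure Ω}
    [IsProbabilityMeasure P] [IsProbabilityMeasure Q] {L : Ω → ℝ≥0∞} (hL : Measurable L)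
    (hQ : Q = P.withDensity L) (hL2 : ∫⁻ x, L x ^ 2 ∂P ≤ 2) {f g : Ω → ℝ≥0∞}
    (hf : Measurable f) (hg : Measurable g) {s : ℝ≥0∞} (hs : ∀ x, s ≤ f x + g x) :
    s / 2 ≤ ∫⁻ x, f x ∂P + ∫⁻ x, g x ∂Q := by
  have hL1 : ∫⁻ x, L x ∂P = 1 := by
    have : Q Set.univ = 1 := measure_univ
    rwa [hQ, withDensity_apply _ MeasurableSet.univ, Measure.restrict_univ] at this
  have hmin : Measurable fun x => min 1 (L x) := measurable_const.min hL
  -- For `L ≥ 1` this is `(L - 2)² ≥ 0`. Integrated, it gives `1 ≤ overlap + 2 / 4`.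
  have hpt : ∀ x, L x ≤ min 1 (L x) + L x ^ 2 / 4 := by
    intro x
    rcases le_total (L x) 1 with h | h
    · rw [min_eq_right h]; exact le_self_add
    · rw [min_eq_left h]
      by_cases ht : L x = ∞
      · simp [ht, ENNReal.top_div]
      · lift L x to ℝ≥0 using ht with l
        have : (l : ℝ) ≤ 1 + l ^ 2 / 4 := by nlinarith [sq_nonneg ((l : ℝ) - 2)]
        have h2 : l ≤ 1 + l ^ 2 / 4 := by exact_mod_cast this
        calc (l : ℝ≥0∞) ≤ ((1 + l ^ 2 / 4 : ℝ≥0) : ℝ≥0∞) := by exact_mod_cast h2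
          _ = 1 + (l : ℝ≥0∞) ^ 2 / 4 := by
            rw [ENNReal.coe_add, ENNReal.coe_div (by norm_num)]; simp
  have hhalf : (1 : ℝ≥0∞) / 2 ≤ ∫⁻ x, min 1 (L x) ∂P := by
    have h1 : (1 : ℝ≥0∞) ≤ ∫⁻ x, min 1 (L x) ∂P + 2⁻¹ := by
      calc (1 : ℝ≥0∞) = ∫⁻ x, L x ∂P := hL1.symm
        _ ≤ ∫⁻ x, (min 1 (L x) + L x ^ 2 / 4) ∂P := lintegral_mono hpt
        _ = ∫⁻ x, min 1 (L x) ∂P + (∫⁻ x, L x ^ 2 ∂P) / 4 := by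
          rw [lintegral_add_left hmin]
          simp_rw [div_eq_mul_inv]
          rw [lintegral_mul_const _ (by fun_prop)]
        _ ≤ ∫⁻ x, min 1 (L x) ∂P + 2⁻¹ := by
          gcongr
          calc (∫⁻ x, L x ^ 2 ∂P) / 4 ≤ 2 / 4 := by gcongr
            _ = 2⁻¹ := by
              rw [show (4 : ℝ≥0∞) = 2 * 2 by norm_num, ENNReal.div_eq_inv_mul, ENNReal.mul_inv (by simp) (by simp), mul_assoc,
                ENNReal.inv_mul_cancel (by simp) (by simp), mul_one]
    have h2 : (1 : ℝ≥0∞) / 2 + 2⁻¹ = 1 := by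
      rw [one_div]; exact ENNReal.inv_two_add_inv_two
    exact (ENNReal.add_le_add_iff_right (a := 2⁻¹) (by simp)).1 (h2.trans_le h1)
  rw [hQ, lintegral_withDensity_eq_lintegral_mul _ hL hg, ← lintegral_add_left hf]
  calc s / 2 = s * (1 / 2) := by rw [div_eq_mul_inv, one_div]
    _ ≤ s * ∫⁻ x, min 1 (L x) ∂P := by gcongr
    _ = ∫⁻ x, s * min 1 (L x) ∂P := (lintegral_const_mul _ hmin).symm
    _ ≤ _ := by
      refine lintegral_mono fun x => ?_
      calc s * min 1 (L x) ≤ (f x + g x) * min 1 (L x) := by gcongr; exact hs x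
        _ = f x * min 1 (L x) + min 1 (L x) * g x := by ring
        _ ≤ f x * 1 + L x * g x := by gcongr <;> simp
        _ = _ := by simp

/-! ### Likelihood ratio of the observations -/

theorem obsOp_apply {N K : ℕ} (M : Matching N K) (Θ : Matrix (Fin N) (Fin K) ℝ) (i : Fin N) :
    obsOp M Θ i = Θ i (M i) := by
  unfold obsOp
  rw [Finset.sum_eq_single i, Finset.sum_eq_single (M i)]
  · simp
  · intro l _ hl; simp [Matrix.single, hl.symm]
  · simp
  · intro k _ hk; simp [Matrix.single, hk.symm]
  · simp

instance instDiscreteMeasurableSpaceMatching (N K : ℕ) :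
    DiscreteMeasurableSpace (Matching N K) := ⟨fun _ => trivial⟩

theorem measurable_obs_of_section {N K : ℕ} {β : Type*} [MeasurableSpace β] {f : Obs N K → β}
    (hf : ∀ M, Measurable fun y => f (M, y)) : Measurable f :=
  measurable_from_prod_countable_right hf

instance (N : ℕ) (σ : ℝ) : IsProbabilityMeasure (noiseLaw N σ) := by
  unfold noiseLaw; infer_instance

theorem measurable_obsMap {N K : ℕ} (Θ : Matrix (Fin N) (Fin K) ℝ) :
    Measurable fun p : Obs N K => (p.1, obsOp p.1 Θ + p.2) :=
  measurable_obs_of_section fun M => by fun_prop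

instance matchingLaw_isFinite (N K : ℕ) : IsFiniteMeasure (matchingLaw N K) := by
  unfold matchingLaw uniformOn; infer_instance

theorem matchingLaw_isProbability {N K : ℕ} (h : N ≤ K) :
    IsProbabilityMeasure (matchingLaw N K) := by
  have : Nonempty (Matching N K) := ⟨Fin.castLEEmb h⟩
  unfold matchingLaw; infer_instance

theorem obsLaw_isProbability {N K : ℕ} (h : N ≤ K) (σ : ℝ) (Θ : Matrix (Fin N) (Fin K) ℝ) :
    IsProbabilityMeasure (obsLaw σ Θ) := by
  have := matchingLaw_isProbability h
  exact Measure.isProbabilityMeasure_map (measurable_obsMap Θ).aemeasurable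

theorem lintegral_obsLaw {N K : ℕ} (σ : ℝ) (Θ : Matrix (Fin N) (Fin K) ℝ) {F : Obs N K → ℝ≥0∞}
    (hF : Measurable F) : ∫⁻ p, F p ∂(obsLaw σ Θ) =
      ∫⁻ M, ∫⁻ e, F (M, obsOp M Θ + e) ∂(noiseLaw N σ) ∂(matchingLaw N K) := by
  rw [obsLaw, lintegral_map hF (measurable_obsMap Θ),
    lintegral_prod (fun p : Obs N K => F (p.1, obsOp p.1 Θ + p.2))
      (hF.comp (measurable_obsMap Θ)).aemeasurable]

theorem toNNReal_sq_ne_zero {σ : ℝ} (hσ : 0 < σ) : (σ ^ 2).toNNReal ≠ 0 := by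
  simpa using hσ.ne'

theorem lintegral_noiseLaw_shift {N : ℕ} {σ : ℝ} (hσ : 0 < σ) (d : Fin N → ℝ)
    {G : (Fin N → ℝ) → ℝ≥0∞} (hG : Measurable G) :
    ∫⁻ e, G (d + e) ∂(noiseLaw N σ) =
      ∫⁻ e, (∏ i, gaussianShift (σ ^ 2).toNNReal (d i) (e i)) * G e ∂(noiseLaw N σ) := by
  have hmap : (noiseLaw N σ).map (fun e => d + e) =
      (noiseLaw N σ).withDensity
        fun e => ∏ i, gaussianShift (σ ^ 2).toNNReal (d i) (e i) := by
    have h1 : (noiseLaw N σ).map (fun e => d + e) =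
        Measure.pi fun i => gaussianReal (d i) (σ ^ 2).toNNReal := by
      unfold noiseLaw
      have := Measure.pi_map_pi (μ := fun _ : Fin N => gaussianReal 0 (σ ^ 2).toNNReal)
        (f := fun i x => d i + x)
        (hμ := fun i => by rw [gaussianReal_map_const_add]; infer_instance)
        (fun i => by fun_prop)
      simp only [gaussianReal_map_const_add, zero_add] at this
      exact this
    rw [h1]
    have h2 := fun i => gaussianReal_eq_withDensity_shift (toNNReal_sq_ne_zero hσ) (d i)
    have : ∀ i, SigmaFinite ((gaussianReal 0 (σ ^ 2).toNNReal).withDensity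
      (gaussianShift (σ ^ 2).toNNReal (d i))) := fun i => by rw [← h2]; infer_instance
    rw [noiseLaw, ← pi_withDensity _ fun i => measurable_gaussianShift _ (d i)]
    simp_rw [← h2]
  rw [← lintegral_map hG (by fun_prop), hmap, lintegral_withDensity_eq_lintegral_mul _ _ hG]
  · rfl
  · exact Finset.measurable_fun_prod _ fun i _ =>
      (measurable_gaussianShift _ _).comp (measurable_pi_apply i)

/-- Likelihood ratio of one observation under `Θ'` against `Θ`. -/
noncomputable def obsRatio {N K : ℕ} (σ : ℝ) (Θ Θ' : Matrix (Fin N) (Fin K) ℝ) (p : Obs N K) :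
    ℝ≥0∞ :=
  ∏ i, gaussianShift (σ ^ 2).toNNReal (Θ' i (p.1 i) - Θ i (p.1 i)) (p.2 i - Θ i (p.1 i))

theorem measurable_obsRatio {N K : ℕ} (σ : ℝ) (Θ Θ' : Matrix (Fin N) (Fin K) ℝ) :
    Measurable (obsRatio σ Θ Θ') := by
  refine measurable_obs_of_section fun M => ?_
  unfold obsRatio
  refine Finset.measurable_fun_prod _ fun i _ => ?_
  have h : Measurable fun y : Fin N → ℝ => y i - Θ i (M i) := by fun_prop
  exact (measurable_gaussianShift _ (Θ' i (M i) - Θ i (M i))).comp h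

theorem obsLaw_eq_withDensity {N K : ℕ} {σ : ℝ} (hσ : 0 < σ)
    (Θ Θ' : Matrix (Fin N) (Fin K) ℝ) :
    obsLaw σ Θ' = (obsLaw σ Θ).withDensity (obsRatio σ Θ Θ') := by
  refine Measure.ext_of_lintegral _ fun F hF => ?_
  rw [lintegral_withDensity_eq_lintegral_mul _ (measurable_obsRatio σ Θ Θ') hF,
    lintegral_obsLaw σ Θ' hF, lintegral_obsLaw σ Θ ((measurable_obsRatio σ Θ Θ').mul hF)]
  refine lintegral_congr fun M => ?_
  have h := lintegral_noiseLaw_shift hσ (obsOp M Θ' - obsOp M Θ)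
    (G := fun e => F (M, obsOp M Θ + e)) (by fun_prop)
  simp only [add_sub_cancel, ← add_assoc] at h
  rw [h]
  refine lintegral_congr fun e => ?_
  simp [obsRatio, obsOp_apply]

/-- Given the matching, the coordinates are independent Gaussians, so only the squared distance seen
through the matching remains, in an exponential moment. -/
theorem lintegral_obsRatio_sq {N K : ℕ} {σ : ℝ} (hσ : 0 < σ)
    (Θ Θ' : Matrix (Fin N) (Fin K) ℝ) :
    ∫⁻ p, obsRatio σ Θ Θ' p ^ 2 ∂(obsLaw σ Θ) =
      ∫⁻ M, ENNReal.ofReal (Real.exp (∑ i, (Θ' i (M i) - Θ i (M i)) ^ 2 / σ ^ 2))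
        ∂(matchingLaw N K) := by
  rw [lintegral_obsLaw σ Θ ((measurable_obsRatio σ Θ Θ').pow_const 2)]
  refine lintegral_congr fun M => ?_
  simp only [obsRatio, obsOp_apply, Pi.add_apply, add_sub_cancel_left, ← Finset.prod_pow]
  rw [noiseLaw, lintegral_pi_prod _ fun i => (measurable_gaussianShift _ _).pow_const 2]
  simp only [lintegral_gaussianShift_sq (toNNReal_sq_ne_zero hσ)]
  rw [Real.exp_sum, ENNReal.ofReal_prod_of_nonneg fun _ _ => (Real.exp_pos _).le]
  simp [sq_nonneg]

theorem sampleLaw_eq_withDensity {N K : ℕ} (h : N ≤ K) (n : ℕ) {σ : ℝ} (hσ : 0 < σ)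
    (Θ Θ' : Matrix (Fin N) (Fin K) ℝ) :
    sampleLaw n σ Θ' = (sampleLaw n σ Θ).withDensity fun S => ∏ t, obsRatio σ Θ Θ' (S t) := by
  have := obsLaw_isProbability h σ Θ
  have := obsLaw_isProbability h σ Θ'
  have h2 := obsLaw_eq_withDensity hσ Θ Θ'
  have : SigmaFinite ((obsLaw σ Θ).withDensity (obsRatio σ Θ Θ')) := by
    rw [← h2]; infer_instance
  rw [sampleLaw, sampleLaw, ← pi_withDensity _ fun _ => measurable_obsRatio σ Θ Θ', ← h2]

theorem lintegral_sampleRatio_sq {N K : ℕ} (h : N ≤ K) (n : ℕ) (σ : ℝ)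
    (Θ Θ' : Matrix (Fin N) (Fin K) ℝ) :
    ∫⁻ S, (∏ t, obsRatio σ Θ Θ' (S t)) ^ 2 ∂(sampleLaw n σ Θ) =
      (∫⁻ p, obsRatio σ Θ Θ' p ^ 2 ∂(obsLaw σ Θ)) ^ n := by
  have := obsLaw_isProbability h σ Θ
  simp only [← Finset.prod_pow]
  rw [sampleLaw, lintegral_pi_prod _ fun _ => (measurable_obsRatio σ Θ Θ').pow_const 2]
  simp

/-! ### Exponential moments of a uniform matching -/

/-- Swapping the columns `j` and `j'` after the matching is a bijection between the two events. -/
theorem matchingLaw_fiber_eq {N K : ℕ} (i : Fin N) (j j' : Fin K) :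
    matchingLaw N K ((fun M : Matching N K => M i) ⁻¹' {j}) =
      matchingLaw N K ((fun M : Matching N K => M i) ⁻¹' {j'}) := by
  let e : Matching N K → Matching N K := fun M => M.trans (Equiv.swap j j').toEmbedding
  have he : Function.Injective e := by
    intro M M' h
    ext k
    have := DFunLike.congr_fun h k
    exact congrArg Fin.val (by simpa [e] using this)
  have himg : e '' ((fun M : Matching N K => M i) ⁻¹' {j}) =
      (fun M : Matching N K => M i) ⁻¹' {j'} := by
    ext M
    constructor
    · rintro ⟨M, hM, rfl⟩
      simp only [Set.mem_preimage, Set.mem_singleton_iff] at hM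
      simp [e, hM]
    · intro hM
      simp only [Set.mem_preimage, Set.mem_singleton_iff] at hM
      refine ⟨e M, by simp [e, hM], ?_⟩
      ext k
      simp [e]
  unfold matchingLaw
  rw [uniformOn_univ, uniformOn_univ, ← himg, Measure.count_apply .of_discrete,
    Measure.count_apply .of_discrete, he.encard_image]

theorem matchingLaw_fiber {N K : ℕ} (h : N ≤ K) (i : Fin N) (j : Fin K) :
    matchingLaw N K ((fun M : Matching N K => M i) ⁻¹' {j}) = (K : ℝ≥0∞)⁻¹ := by
  have := matchingLaw_isProbability h
  have hsum := sum_measure_preimage_singleton (μ := matchingLaw N K) Finset.univ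
    (f := fun M : Matching N K => M i) fun _ _ => .of_discrete
  rw [Finset.coe_univ, Set.preimage_univ, measure_univ,
    Finset.sum_congr rfl fun j' _ => matchingLaw_fiber_eq i j' j, Finset.sum_const,
    Finset.card_univ, Fintype.card_fin, nsmul_eq_mul] at hsum
  exact ENNReal.eq_inv_of_mul_eq_one_left ((mul_comm _ _).trans hsum)

/-- Since a matching is injective, at most one of the pairs `(i, M i)` with `i ∈ G` lies in
column `j`, so the exponential moment is only linear in `#G / K`. -/
theorem lintegral_exp_sum_matching_le {N K : ℕ} (hNK : N ≤ K) (G : Finset (Fin N)) (j : Fin K)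
    {s : ℝ} (hs : 0 ≤ s) {h : Fin N → Fin K → ℝ}
    (hh : ∀ i l, h i l ≤ if i ∈ G ∧ l = j then s else 0) :
    ∫⁻ M, ENNReal.ofReal (Real.exp (∑ i, h i (M i))) ∂(matchingLaw N K) ≤
      ENNReal.ofReal (1 + (G.card : ℝ) / K * (Real.exp s - 1)) := by
  have := matchingLaw_isProbability hNK
  have hK : (0 : ℝ) < K := by exact_mod_cast (Nat.zero_le _).trans_lt j.isLt
  have hes : 0 ≤ Real.exp s - 1 := by linarith [Real.add_one_le_exp s]
  -- The exponential is at most `exp s` if a row of `G` is matched to `j`, and at most `1`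
  -- otherwise; the indicators carry the excess.
  have hpt : ∀ M : Matching N K, ENNReal.ofReal (Real.exp (∑ i, h i (M i))) ≤
      1 + ∑ i ∈ G, ((fun M : Matching N K => M i) ⁻¹' {j}).indicator
        (fun _ => ENNReal.ofReal (Real.exp s - 1)) M := by
    intro M
    have hle : ∑ i, h i (M i) ≤ ∑ i, if i ∈ G ∧ M i = j then s else 0 :=
      Finset.sum_le_sum fun i _ => hh i (M i)
    by_cases hex : ∃ i ∈ G, M i = j
    · obtain ⟨i, hi, hij⟩ := hex
      have h1 : (∑ k, if k ∈ G ∧ M k = j then s else 0) = s := by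
        rw [Finset.sum_eq_single i]
        · simp [hi, hij]
        · intro k _ hk
          rw [if_neg]
          rintro ⟨-, hkj⟩
          exact hk (M.injective (hkj.trans hij.symm))
        · simp
      calc ENNReal.ofReal (Real.exp (∑ i, h i (M i)))
          ≤ ENNReal.ofReal (1 + (Real.exp s - 1)) := by
            apply ENNReal.ofReal_le_ofReal
            rw [add_sub_cancel]
            exact Real.exp_le_exp.2 (hle.trans h1.le)
        _ = 1 + ENNReal.ofReal (Real.exp s - 1) := by
            rw [ENNReal.ofReal_add zero_le_one hes, ENNReal.ofReal_one]
        _ ≤ _ := by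
            gcongr
            refine le_trans (le_of_eq ?_) (Finset.single_le_sum
              (f := fun i => ((fun M : Matching N K => M i) ⁻¹' {j}).indicator
                (fun _ => ENNReal.ofReal (Real.exp s - 1)) M) (fun _ _ => zero_le) hi)
            rw [Set.indicator_of_mem (by simpa using hij)]
    · push Not at hex
      have h1 : (∑ k, if k ∈ G ∧ M k = j then s else 0) = 0 :=
        Finset.sum_eq_zero fun k _ => if_neg fun hk => hex k hk.1 hk.2
      refine le_trans ?_ le_self_add
      rw [← ENNReal.ofReal_one]
      apply ENNReal.ofReal_le_ofReal
      rw [← Real.exp_zero]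
      exact Real.exp_le_exp.2 (hle.trans h1.le)
  calc _ ≤ ∫⁻ M, (1 + ∑ i ∈ G, ((fun M : Matching N K => M i) ⁻¹' {j}).indicator
        (fun _ => ENNReal.ofReal (Real.exp s - 1)) M) ∂(matchingLaw N K) := lintegral_mono hpt
    _ = 1 + ∑ i ∈ G, ENNReal.ofReal (Real.exp s - 1) * (K : ℝ≥0∞)⁻¹ := by
      rw [lintegral_add_left measurable_const, lintegral_const, measure_univ, mul_one,
        lintegral_finsetSum _ fun _ _ => .of_discrete]
      congr 1
      refine Finset.sum_congr rfl fun i _ => ?_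
      rw [lintegral_indicator_const .of_discrete, matchingLaw_fiber hNK]
    _ = _ := by
      rw [Finset.sum_const, nsmul_eq_mul, ENNReal.ofReal_add zero_le_one (by positivity),
        ENNReal.ofReal_one, ENNReal.ofReal_mul (by positivity), ENNReal.ofReal_div_of_pos hK,
        ENNReal.ofReal_natCast, ENNReal.ofReal_natCast, div_eq_mul_inv]
      ring

/-! ### The hypercube of rank-`r` matrices -/

/-- The block of consecutive rows of length `m` that contains row `i`. -/
def rowBlock {N : ℕ} (m : ℕ) (i : Fin N) : Fin N := ⟨i / m, (Nat.div_le_self _ _).trans_lt i.isLt⟩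

theorem card_rowBlock_fiber_le {N : ℕ} {m : ℕ} (hm : 0 < m) (g : Fin N) :
    (Finset.univ.filter fun i : Fin N => rowBlock m i = g).card ≤ m := by
  calc _ ≤ (Finset.Ico (g * m) (g * m + m)).card := by
        refine Finset.card_le_card_of_injOn (fun i => (i : ℕ)) ?_ fun a _ b _ h => Fin.ext h
        intro i hi
        have hg : (i : ℕ) / m = g := by
          simpa [rowBlock, Fin.ext_iff] using hi
        have := (Nat.div_eq_iff hm).1 hg
        simp only [Finset.coe_Ico, Set.mem_Ico]
        omega
    _ = m := by simp

/-- A matrix with `r` blocks of `m` equal rows; the `r × K` matrix of distinct rows is upper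
trapezoidal, has `1 / 2` on its diagonal, and is perturbed by `γ` where `ε` says so. -/
noncomputable def hypMatrix {N K : ℕ} (m r : ℕ) (γ : ℝ) (ε : Fin N × Fin K → Bool) :
    Matrix (Fin N) (Fin K) ℝ := fun i j =>
  if (i : ℕ) / m < r ∧ (i : ℕ) / m ≤ j then
    (if (i : ℕ) / m = j then 1 / 2 else 0) + (if ε (rowBlock m i, j) then γ else 0)
  else 0

theorem abs_hypMatrix_le {N K : ℕ} (m r : ℕ) {γ : ℝ} (h0 : 0 ≤ γ) (h1 : γ ≤ 1 / 2)
    (ε : Fin N × Fin K → Bool) (i : Fin N) (j : Fin K) : |hypMatrix m r γ ε i j| ≤ 1 := by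
  unfold hypMatrix
  rw [abs_le]
  split_ifs <;> constructor <;> linarith

/-- The matrix factors through `Fin r` (block membership times distinct rows), so its rank is at
most `r`. The first row of each block and the first `r` columns give an upper triangular minor with
diagonal entries `1 / 2` or `1 / 2 + γ`, hence invertible. -/
theorem rank_hypMatrix {N K m r : ℕ} (hm : 0 < m) (hmr : m * r ≤ N) (hNK : N ≤ K) {γ : ℝ}
    (h0 : 0 ≤ γ) (ε : Fin N × Fin K → Bool) : (hypMatrix m r γ ε).rank = r := by
  have hrN : r ≤ N := (Nat.le_mul_of_pos_left r hm).trans hmr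
  have hlt : ∀ g : Fin r, (g : ℕ) * m < N := fun g => by
    calc (g : ℕ) * m < r * m := Nat.mul_lt_mul_of_pos_right g.isLt hm
      _ ≤ N := by rwa [mul_comm]
  apply le_antisymm
  · let P : Matrix (Fin N) (Fin r) ℝ := fun i g => if (i : ℕ) / m = g then 1 else 0
    let B : Matrix (Fin r) (Fin K) ℝ := fun g j =>
      if (g : ℕ) ≤ j then (if (g : ℕ) = j then 1 / 2 else 0) +
        (if ε (⟨g, g.isLt.trans_le hrN⟩, j) then γ else 0) else 0
    have hPB : hypMatrix m r γ ε = P * B := by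
      ext i j
      rw [Matrix.mul_apply]
      by_cases hi : (i : ℕ) / m < r
      · rw [Finset.sum_eq_single ⟨(i : ℕ) / m, hi⟩]
        · simp [P, B, hypMatrix, hi, rowBlock]
          rfl
        · intro g _ hg
          have : (i : ℕ) / m ≠ g := fun h => hg (Fin.ext h.symm)
          simp [P, this]
        · simp
      · rw [Finset.sum_eq_zero]
        · simp [hypMatrix, hi]
        · intro g _
          have : (i : ℕ) / m ≠ g := fun h => hi (h ▸ g.isLt)
          simp [P, this]
    rw [hPB]
    exact (Matrix.rank_mul_le_left P B).trans (Matrix.rank_le_width P)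
  · let A : Matrix (Fin r) (Fin r) ℝ := (hypMatrix m r γ ε).submatrix
      (fun g => ⟨g * m, hlt g⟩) (Fin.castLE (hrN.trans hNK))
    have hA : A.IsUpperTriangular := by
      intro i j hij
      have : ¬ (i : ℕ) ≤ j := not_le.2 hij
      simp [A, hypMatrix, Nat.mul_div_cancel _ hm, this]
    have hd : ∀ g, A g g ≠ 0 := by
      intro g
      simp only [A, hypMatrix, Matrix.submatrix_apply, Nat.mul_div_cancel _ hm, g.isLt,
        Fin.val_castLE, le_refl, and_self, if_true]
      split_ifs <;> positivity
    have hdet : A.det ≠ 0 := by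
      rw [Matrix.det_of_isUpperTriangular hA]
      exact Finset.prod_ne_zero_iff.2 fun g _ => hd g
    calc r = A.rank := by
          rw [Matrix.rank_of_isUnit A ((Matrix.isUnit_iff_isUnit_det A).2 hdet.isUnit),
            Fintype.card_fin]
      _ ≤ _ := Matrix.rank_submatrix_le _ _ _

theorem hypMatrix_mem_paramSet {N K m r : ℕ} (hm : 0 < m) (hmr : m * r ≤ N) (hNK : N ≤ K) {γ : ℝ}
    (h0 : 0 ≤ γ) (h1 : γ ≤ 1 / 2) (ε : Fin N × Fin K → Bool) :
    hypMatrix m r γ ε ∈ paramSet N K r :=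
  ⟨rank_hypMatrix hm hmr hNK h0 ε, abs_hypMatrix_le m r h0 h1 ε⟩

/-- Flip one coordinate of a sign pattern. -/
def flipAt {ι : Type*} [DecidableEq ι] (x : ι) (ε : ι → Bool) : ι → Bool :=
  Function.update ε x (!ε x)

theorem flipAt_involutive {ι : Type*} [DecidableEq ι] (x : ι) :
    Function.Involutive (flipAt x) := by
  intro ε
  simp [flipAt]

theorem hypMatrix_flip_sub_sq_le {N K m r : ℕ} (γ : ℝ) (ε : Fin N × Fin K → Bool)
    (g : Fin N) (j : Fin K) (i : Fin N) (l : Fin K) :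
    (hypMatrix m r γ (flipAt (g, j) ε) i l - hypMatrix m r γ ε i l) ^ 2 ≤
      if i ∈ (Finset.univ.filter fun i : Fin N => rowBlock m i = g) ∧ l = j then γ ^ 2 else 0 := by
  simp only [Finset.mem_filter, Finset.mem_univ, true_and]
  by_cases h : rowBlock m i = g ∧ l = j
  · rw [if_pos h]
    unfold hypMatrix
    split_ifs <;> nlinarith [sq_nonneg γ]
  · rw [if_neg h]
    have : (rowBlock m i, l) ≠ (g, j) := fun h' => h (Prod.mk.injEq _ _ _ _ ▸ h')
    simp [hypMatrix, flipAt, Function.update_of_ne this]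

theorem abs_hypMatrix_flip_sub {N K m r : ℕ} {γ : ℝ} (h0 : 0 ≤ γ) (ε : Fin N × Fin K → Bool)
    (i : Fin N) (j : Fin K) (h : (i : ℕ) / m < r ∧ (i : ℕ) / m ≤ j) :
    |hypMatrix m r γ (flipAt (rowBlock m i, j) ε) i j - hypMatrix m r γ ε i j| = γ := by
  simp only [hypMatrix, if_pos h, flipAt, Function.update_self]
  cases ε (rowBlock m i, j) <;> simp [abs_of_nonneg h0]

theorem sum_range_sub_div (K m r : ℕ) (hm : 0 < m) :
    2 * ∑ i ∈ Finset.range (m * r), ((K : ℝ) - (i / m : ℕ)) = m * r * (2 * K - r + 1) := by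
  induction r with
  | zero => simp
  | succ r ih =>
    rw [Nat.mul_succ, Finset.sum_range_add, mul_add, ih]
    have : ∀ x ∈ Finset.range m, ((K : ℝ) - ((m * r + x) / m : ℕ)) = K - r := by
      intro x hx
      rw [Nat.mul_add_div hm, Nat.div_eq_of_lt (Finset.mem_range.1 hx), add_zero]
    rw [Finset.sum_congr rfl this, Finset.sum_const, Finset.card_range, nsmul_eq_mul]
    push_cast
    ring

/-- The triangular shape keeps at least half of the first `m * r` rows, and these are at least half
of all `N` rows. -/
theorem card_free_entries_ge {N K m r : ℕ} (hm : 0 < m) (hmr : m * r ≤ N) (hrK : r ≤ K)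
    (hN : N ≤ 2 * (m * r)) :
    (N * K : ℝ) / 4 ≤ ((Finset.univ.filter fun p : Fin N × Fin K =>
      (p.1 : ℕ) / m < r ∧ (p.1 : ℕ) / m ≤ p.2).card : ℝ) := by
  have h1 : ((Finset.univ.filter fun p : Fin N × Fin K =>
      (p.1 : ℕ) / m < r ∧ (p.1 : ℕ) / m ≤ p.2).card : ℝ) =
      ∑ i ∈ Finset.range N, ∑ j ∈ Finset.range K,
        (if i / m < r ∧ i / m ≤ j then (1 : ℝ) else 0) := by
    rw [Finset.card_filter, Nat.cast_sum, Fintype.sum_prod_type, ← Fin.sum_univ_eq_sum_range]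
    refine Finset.sum_congr rfl fun i _ => ?_
    rw [← Fin.sum_univ_eq_sum_range fun j => if (i : ℕ) / m < r ∧ (i : ℕ) / m ≤ j then (1 : ℝ) else 0]
    simp
  have h2 : ∑ i ∈ Finset.range (m * r), ((K : ℝ) - (i / m : ℕ)) ≤
      ∑ i ∈ Finset.range N, ∑ j ∈ Finset.range K,
        (if i / m < r ∧ i / m ≤ j then (1 : ℝ) else 0) := by
    refine le_trans (Finset.sum_le_sum fun i hi => ?_) (Finset.sum_le_sum_of_subset_of_nonneg
      (Finset.range_subset_range.2 hmr) fun _ _ _ => Finset.sum_nonneg fun _ _ => by positivity)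
    have hir : i / m < r := Nat.div_lt_of_lt_mul (Finset.mem_range.1 hi)
    have hsub : Finset.Ico (i / m) K ⊆ Finset.range K := fun x hx => by
      simp only [Finset.mem_Ico, Finset.mem_range] at hx ⊢; omega
    calc ((K : ℝ) - (i / m : ℕ)) = ∑ j ∈ Finset.Ico (i / m) K, (1 : ℝ) := by
          simp [Nat.cast_sub (hir.le.trans hrK)]
      _ ≤ ∑ j ∈ Finset.Ico (i / m) K, (if i / m < r ∧ i / m ≤ j then (1 : ℝ) else 0) := by
          refine Finset.sum_le_sum fun j hj => ?_
          rw [if_pos ⟨hir, (Finset.mem_Ico.1 hj).1⟩]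
      _ ≤ _ := Finset.sum_le_sum_of_subset_of_nonneg hsub fun _ _ _ => by positivity
  have h3 := sum_range_sub_div K m r hm
  have h4 : (N : ℝ) ≤ 2 * (m * r) := by exact_mod_cast hN
  have h5 : (r : ℝ) ≤ K := by exact_mod_cast hrK
  have h6 : (m * r : ℝ) * K ≤ m * r * (2 * K - r + 1) := by
    gcongr
    linarith
  rw [h1]
  nlinarith [mul_le_mul_of_nonneg_right h4 (Nat.cast_nonneg (α := ℝ) K)]

/-! ### Assouad's argument on the entrywise risk -/

/-- The expected absolute error of an estimator in one entry. -/
noncomputable def entryRisk {N K n : ℕ} (σ : ℝ) (est : Estimator N K n)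
    (Θ : Matrix (Fin N) (Fin K) ℝ) (i : Fin N) (j : Fin K) : ℝ≥0∞ :=
  ∫⁻ S, ∫⁻ A, ENNReal.ofReal |A i j - Θ i j| ∂(est.1 S) ∂(sampleLaw n σ Θ)

theorem measurable_matrix_entry {N K : ℕ} (i : Fin N) (j : Fin K) :
    Measurable fun A : Matrix (Fin N) (Fin K) ℝ => A i j :=
  (measurable_pi_apply j).comp (measurable_pi_apply i)

theorem measurable_entryError {N K : ℕ} (x : ℝ) (i : Fin N) (j : Fin K) :
    Measurable fun A : Matrix (Fin N) (Fin K) ℝ => ENNReal.ofReal |A i j - x| := by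
  have := measurable_matrix_entry i j
  fun_prop

theorem entryRisk_add_ge {N K n : ℕ} (hNK : N ≤ K) {σ : ℝ} (hσ : 0 < σ) (est : Estimator N K n)
    (Θ Θ' : Matrix (Fin N) (Fin K) ℝ)
    (hL : (∫⁻ p, obsRatio σ Θ Θ' p ^ 2 ∂(obsLaw σ Θ)) ^ n ≤ 2) (i : Fin N) (j : Fin K) :
    ENNReal.ofReal |Θ' i j - Θ i j| / 2 ≤ entryRisk σ est Θ i j + entryRisk σ est Θ' i j := by
  have := obsLaw_isProbability hNK σ Θ
  have := obsLaw_isProbability hNK σ Θ'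
  have : IsProbabilityMeasure (sampleLaw n σ Θ) := by unfold sampleLaw; infer_instance
  have : IsProbabilityMeasure (sampleLaw n σ Θ') := by unfold sampleLaw; infer_instance
  have := est.2
  refine two_point_bound
    (Finset.measurable_fun_prod _ fun t _ => (measurable_obsRatio σ Θ Θ').comp (measurable_pi_apply t))
    (sampleLaw_eq_withDensity hNK n hσ Θ Θ')
    ((lintegral_sampleRatio_sq hNK n σ Θ Θ').trans_le hL)
    (measurable_entryError _ i j).lintegral_kernel (measurable_entryError _ i j).lintegral_kernel
    fun S => ?_
  rw [← lintegral_add_left (measurable_entryError _ i j)]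
  calc ENNReal.ofReal |Θ' i j - Θ i j|
      = ∫⁻ _, ENNReal.ofReal |Θ' i j - Θ i j| ∂(est.1 S) := by simp
    _ ≤ _ := by
      refine lintegral_mono fun A => ?_
      rw [← ENNReal.ofReal_add (abs_nonneg _) (abs_nonneg _)]
      apply ENNReal.ofReal_le_ofReal
      rw [add_comm, abs_sub_comm (A i j) (Θ' i j)]
      exact (abs_sub_le _ (A i j) _).trans_eq (by ring)

/-- Cauchy–Schwarz over all `N * K` entries. It links the entrywise losses, to which the two-point
bound applies, to the Frobenius loss. -/
theorem sum_abs_le_frobNorm {N K : ℕ} (F : Finset (Fin N × Fin K))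
    (A : Matrix (Fin N) (Fin K) ℝ) :
    ∑ p ∈ F, |A p.1 p.2| ≤ √(N * K) * frobNorm A := by
  rw [frobNorm, ← Real.sqrt_mul (by positivity)]
  refine Real.le_sqrt_of_sq_le ?_
  have h1 : ∑ p ∈ F, |A p.1 p.2| ≤ ∑ p : Fin N × Fin K, |A p.1 p.2| :=
    Finset.sum_le_sum_of_subset_of_nonneg (Finset.subset_univ _) fun _ _ _ => abs_nonneg _
  have h2 := sq_sum_le_card_mul_sum_sq (s := (Finset.univ : Finset (Fin N × Fin K)))
    (f := fun p => |A p.1 p.2|)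
  simp only [Finset.card_univ, Fintype.card_prod, Fintype.card_fin, sq_abs, Nat.cast_mul,
    Fintype.sum_prod_type] at h2
  rw [Fintype.sum_prod_type] at h1
  exact (pow_le_pow_left₀ (Finset.sum_nonneg fun _ _ => abs_nonneg _) h1 2).trans h2

theorem sum_entryRisk_le {N K n : ℕ} (σ : ℝ) (est : Estimator N K n)
    (Θ : Matrix (Fin N) (Fin K) ℝ) (F : Finset (Fin N × Fin K)) :
    ∑ p ∈ F, entryRisk σ est Θ p.1 p.2 ≤ ENNReal.ofReal √(N * K) * risk σ est Θ := by
  have := est.2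
  have hfrob : Measurable fun A : Matrix (Fin N) (Fin K) ℝ => ENNReal.ofReal (frobNorm (A - Θ)) := by
    unfold frobNorm
    refine ENNReal.measurable_ofReal.comp (Measurable.sqrt ?_)
    refine Finset.measurable_fun_sum _ fun i _ => Finset.measurable_fun_sum _ fun j _ => ?_
    exact ((measurable_matrix_entry i j).sub_const (Θ i j)).pow_const 2
  unfold entryRisk risk
  rw [← lintegral_finsetSum _ fun p _ => (measurable_entryError _ p.1 p.2).lintegral_kernel,
    ← lintegral_const_mul _ hfrob.lintegral_kernel]
  refine lintegral_mono fun S => ?_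
  rw [← lintegral_finsetSum _ fun p _ => measurable_entryError _ p.1 p.2,
    ← lintegral_const_mul _ hfrob]
  refine lintegral_mono fun A => ?_
  rw [← ENNReal.ofReal_sum_of_nonneg fun _ _ => abs_nonneg _,
    ← ENNReal.ofReal_mul (Real.sqrt_nonneg _)]
  exact ENNReal.ofReal_le_ofReal (sum_abs_le_frobNorm F (A - Θ))

/-- The supremum dominates the average over all sign patterns. In `1 / 16`, a factor `1 / 4` is the
share of free entries, `1 / 2` the two-point loss, and `1 / 2` comes from splitting it between two
neighbours. -/
theorem assouad_bound {N K n m r : ℕ} (hN0 : 0 < N) (hm : 0 < m) (hmr : m * r ≤ N) (hNK : N ≤ K)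
    (hN : N ≤ 2 * (m * r)) {σ γ : ℝ} (hσ : 0 < σ) (h0 : 0 ≤ γ) (h1 : γ ≤ 1 / 2)
    (hinfo : (1 + (m : ℝ) / K * (Real.exp (γ ^ 2 / σ ^ 2) - 1)) ^ n ≤ 2) :
    ENNReal.ofReal (N * K * γ / 16) ≤ ENNReal.ofReal √(N * K) * minimaxRisk N K r n σ := by
  unfold minimaxRisk
  have hw : 0 < √((N : ℝ) * K) := by
    have : 0 < K := hN0.trans_le hNK
    positivity
  rw [ENNReal.mul_iInf_of_ne (ENNReal.ofReal_pos.2 hw).ne' ENNReal.ofReal_ne_top]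
  refine le_iInf fun est => ?_
  set s := ⨆ Θ ∈ paramSet N K r, risk σ est Θ
  let Θ : (Fin N × Fin K → Bool) → Matrix (Fin N) (Fin K) ℝ := hypMatrix m r γ
  let F := Finset.univ.filter fun p : Fin N × Fin K =>
    (p.1 : ℕ) / m < r ∧ (p.1 : ℕ) / m ≤ p.2
  let C : ℝ := Fintype.card (Fin N × Fin K → Bool)
  have hC : 0 < C := by simp [C]
  have hes : 0 ≤ Real.exp (γ ^ 2 / σ ^ 2) - 1 := by
    have : 0 ≤ γ ^ 2 / σ ^ 2 := by positivity
    linarith [Real.add_one_le_exp (γ ^ 2 / σ ^ 2)]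
  have hpair : ∀ p ∈ F, ∀ ε, ENNReal.ofReal (γ / 2) ≤
      entryRisk σ est (Θ ε) p.1 p.2 +
        entryRisk σ est (Θ (flipAt (rowBlock m p.1, p.2) ε)) p.1 p.2 := by
    intro p hp ε
    have hp' := (Finset.mem_filter.1 hp).2
    have hL : (∫⁻ q, obsRatio σ (Θ ε) (Θ (flipAt (rowBlock m p.1, p.2) ε)) q ^ 2
        ∂(obsLaw σ (Θ ε))) ^ n ≤ 2 := by
      rw [lintegral_obsRatio_sq hσ]
      have hb := lintegral_exp_sum_matching_le hNK
        (Finset.univ.filter fun i : Fin N => rowBlock m i = rowBlock m p.1) p.2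
        (s := γ ^ 2 / σ ^ 2) (by positivity)
        (h := fun i l => (Θ (flipAt (rowBlock m p.1, p.2) ε) i l - Θ ε i l) ^ 2 / σ ^ 2)
        (by
          intro i l
          have h := hypMatrix_flip_sub_sq_le (m := m) (r := r) γ ε (rowBlock m p.1) p.2 i l
          have h' := div_le_div_of_nonneg_right h (sq_nonneg σ)
          rwa [ite_div, zero_div] at h')
      refine (pow_le_pow_left₀ zero_le hb n).trans ?_
      rw [← ENNReal.ofReal_pow (by positivity)]
      refine (ENNReal.ofReal_le_ofReal (le_trans ?_ hinfo)).trans_eq (by simp)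
      gcongr
      exact card_rowBlock_fiber_le hm _
    have h := entryRisk_add_ge hNK hσ est (Θ ε) (Θ (flipAt (rowBlock m p.1, p.2) ε)) hL p.1 p.2
    rw [abs_hypMatrix_flip_sub h0 ε p.1 p.2 hp'] at h
    rwa [ENNReal.ofReal_div_of_pos two_pos, ENNReal.ofReal_ofNat]
  have hentry : ∀ p ∈ F, ENNReal.ofReal (C * (γ / 2)) ≤
      2 * ∑ ε, entryRisk σ est (Θ ε) p.1 p.2 := by
    intro p hp
    -- Flipping permutes the cube, so both neighbours contribute the same sum.
    have hflip : ∑ ε, entryRisk σ est (Θ (flipAt (rowBlock m p.1, p.2) ε)) p.1 p.2 =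
        ∑ ε, entryRisk σ est (Θ ε) p.1 p.2 :=
      Equiv.sum_comp (flipAt_involutive (rowBlock m p.1, p.2)).toPerm
        fun ε => entryRisk σ est (Θ ε) p.1 p.2
    calc ENNReal.ofReal (C * (γ / 2)) = ∑ _ε : Fin N × Fin K → Bool, ENNReal.ofReal (γ / 2) := by
          rw [Finset.sum_const, nsmul_eq_mul, ENNReal.ofReal_mul hC.le, Finset.card_univ,
            ENNReal.ofReal_natCast]
      _ ≤ _ := Finset.sum_le_sum fun ε _ => hpair p hp ε
      _ = _ := by rw [Finset.sum_add_distrib, hflip, two_mul]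
  have hrisk : ∀ ε, ∑ p ∈ F, entryRisk σ est (Θ ε) p.1 p.2 ≤ ENNReal.ofReal √(N * K) * s := by
    intro ε
    refine (sum_entryRisk_le σ est (Θ ε) F).trans ?_
    gcongr
    exact le_iSup₂_of_le (Θ ε) (hypMatrix_mem_paramSet hm hmr hNK h0 h1 ε) le_rfl
  have hrK : r ≤ K := (Nat.le_mul_of_pos_left r hm).trans (hmr.trans hNK)
  have hF := card_free_entries_ge hm hmr hrK hN
  have htot : ENNReal.ofReal (2 * C) * ENNReal.ofReal (N * K * γ / 16) ≤
      ENNReal.ofReal (2 * C) * (ENNReal.ofReal √(N * K) * s) := by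
    calc ENNReal.ofReal (2 * C) * ENNReal.ofReal (N * K * γ / 16)
        = ENNReal.ofReal ((N * K / 4) * (C * (γ / 2))) := by
          rw [← ENNReal.ofReal_mul (by positivity)]
          congr 1; ring
      _ ≤ ENNReal.ofReal (F.card * (C * (γ / 2))) := by
          apply ENNReal.ofReal_le_ofReal
          gcongr
      _ = ∑ _p ∈ F, ENNReal.ofReal (C * (γ / 2)) := by
          rw [Finset.sum_const, nsmul_eq_mul, ENNReal.ofReal_mul (by positivity),
            ENNReal.ofReal_natCast]
      _ ≤ ∑ p ∈ F, 2 * ∑ ε, entryRisk σ est (Θ ε) p.1 p.2 := Finset.sum_le_sum hentry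
      _ = 2 * ∑ ε, ∑ p ∈ F, entryRisk σ est (Θ ε) p.1 p.2 := by
          rw [← Finset.mul_sum, Finset.sum_comm]
      _ ≤ 2 * ∑ _ε : Fin N × Fin K → Bool, ENNReal.ofReal √(N * K) * s := by
          gcongr with ε
          exact hrisk ε
      _ = _ := by
          rw [Finset.sum_const, nsmul_eq_mul, ENNReal.ofReal_mul two_pos.le,
            ENNReal.ofReal_ofNat, Finset.card_univ, ENNReal.ofReal_natCast, mul_assoc]
  exact (ENNReal.mul_le_mul_iff_right (by simpa using hC) ENNReal.ofReal_ne_top).1 htot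

/-! ### Choice of the parameters -/

/-- On `[0, 1]`, `exp s - 1 ≤ 2 * s`, so the power is at most `exp (1 / 2)`, which is below `2`
because `e < 4`. -/
theorem one_add_mul_exp_sub_one_pow_le_two {x s : ℝ} (hx : 0 ≤ x) (hs : 0 ≤ s) (hs1 : s ≤ 1)
    {n : ℕ} (h : n * (x * s) ≤ 1 / 4) : (1 + x * (Real.exp s - 1)) ^ n ≤ 2 := by
  have h1 : Real.exp s - 1 ≤ 2 * s := by
    have := Real.abs_exp_sub_one_le (x := s) (by rwa [abs_of_nonneg hs])
    rw [abs_of_nonneg hs] at this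
    exact (le_abs_self _).trans this
  have h2 : 0 ≤ Real.exp s - 1 := by linarith [Real.add_one_le_exp s]
  calc (1 + x * (Real.exp s - 1)) ^ n ≤ Real.exp (x * (Real.exp s - 1)) ^ n := by
        gcongr
        linarith [Real.add_one_le_exp (x * (Real.exp s - 1))]
    _ = Real.exp (n * (x * (Real.exp s - 1))) := (Real.exp_nat_mul _ _).symm
    _ ≤ Real.exp (1 / 2) := by
        apply Real.exp_le_exp.2
        calc (n : ℝ) * (x * (Real.exp s - 1)) ≤ n * (x * (2 * s)) := by gcongr
          _ = 2 * (n * (x * s)) := by ring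
          _ ≤ 1 / 2 := by linarith
    _ ≤ 2 := by
        have h3 : Real.exp (1 / 2) ^ 2 = Real.exp 1 := by
          rw [← Real.exp_nat_mul]; norm_num
        nlinarith [Real.exp_one_lt_d9, Real.exp_pos (1 / 2)]

end MatchingCompletion

theorem theorem2 (a : ℝ) (ha : 0 < a) :
    ∃ c : ℝ, 0 < c ∧ ∀ (N K r n : ℕ) (σ : ℝ),
      1 ≤ r → r ≤ N → N ≤ K → 0 < σ →
      a * ((r : ℝ) * (K : ℝ)) ≤ (n : ℝ) * (N : ℝ) →
      ENNReal.ofReal (c * min σ 1 * ((K : ℝ) * √((r : ℝ) / (n : ℝ)))) ≤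
        MatchingCompletion.minimaxRisk N K r n σ := by
  have hsa : 0 < √a := Real.sqrt_pos.2 ha
  -- The cap `√a / 2` yields `c₀ * q ≤ 1 / 2`, since `√a * q ≤ 1` below; the cap `1 / 2` yields the
  -- information budget `c₀ ^ 2 ≤ 1 / 4`.
  set c₀ : ℝ := min (1 / 2) (√a / 2) with hc₀
  have hc₀pos : 0 < c₀ := by positivity
  have hc₀half : c₀ ≤ 1 / 2 := min_le_left _ _
  have hc₀a : c₀ ≤ √a / 2 := min_le_right _ _
  refine ⟨c₀ / 16, by positivity, fun N K r n σ hr hrN hNK hσ hn => ?_⟩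
  have hr' : (0 : ℝ) < r := by exact_mod_cast hr
  have hN' : (0 : ℝ) < N := by exact_mod_cast hr.trans hrN
  have hK' : (0 : ℝ) < K := by exact_mod_cast hr.trans (hrN.trans hNK)
  have hn' : (0 : ℝ) < n := by
    have : 0 < (n : ℝ) * N := lt_of_lt_of_le (by positivity) hn
    exact pos_of_mul_pos_left this hN'.le
  set q : ℝ := √(r * K / (n * N)) with hq
  have hq0 : 0 ≤ q := Real.sqrt_nonneg _
  have hq2 : q ^ 2 = r * K / (n * N) := Real.sq_sqrt (by positivity)
  have haq : √a * q ≤ 1 := by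
    rw [hq, ← Real.sqrt_mul ha.le, Real.sqrt_le_one, ← mul_div_assoc,
      div_le_one (by positivity)]
    exact hn
  have hcq : c₀ * q ≤ 1 / 2 := by nlinarith
  have hmin0 : 0 < min σ 1 := lt_min hσ one_pos
  -- The factor `σ` bounds the information `γ² / σ²`; the factor `1` keeps the entries bounded when
  -- the noise is large.
  set γ : ℝ := c₀ * min σ 1 * q with hγ
  have hγ0 : 0 ≤ γ := by positivity
  have hγ1 : γ ≤ 1 / 2 := by
    calc γ = c₀ * q * min σ 1 := by ring
      _ ≤ 1 / 2 * 1 := by gcongr; exact min_le_right _ _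
      _ = 1 / 2 := mul_one _
  have hγσ : γ ≤ c₀ * q * σ := by
    calc γ = c₀ * q * min σ 1 := by ring
      _ ≤ _ := by gcongr; exact min_le_left _ _
  have hs : γ ^ 2 / σ ^ 2 ≤ (c₀ * q) ^ 2 := by
    rw [div_le_iff₀ (by positivity), ← mul_pow]
    exact pow_le_pow_left₀ hγ0 hγσ 2
  set m := N / r with hmdef
  have hm : 0 < m := Nat.div_pos hrN hr
  have hmr : m * r ≤ N := Nat.div_mul_le_self N r
  -- The remainder of `N` modulo `r` is below `r ≤ m * r`, as `m ≥ 1`.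
  have hN2 : N ≤ 2 * (m * r) := by
    have h1 := Nat.div_add_mod' N r
    have h2 := Nat.mod_lt N hr
    have h3 : r ≤ m * r := Nat.le_mul_of_pos_left r hm
    rw [← hmdef] at h1
    omega
  have hmr' : (m : ℝ) * r ≤ N := by exact_mod_cast hmr
  have hinfo : (n : ℝ) * ((m : ℝ) / K * (γ ^ 2 / σ ^ 2)) ≤ 1 / 4 := by
    calc (n : ℝ) * ((m : ℝ) / K * (γ ^ 2 / σ ^ 2)) ≤ n * (m / K * (c₀ * q) ^ 2) := by gcongr
      _ = c₀ ^ 2 * (m * r / N) := by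
        rw [mul_pow, hq2]; field_simp
      _ ≤ (1 / 2) ^ 2 * 1 := by
        gcongr
        exact (div_le_one hN').2 hmr'
      _ = 1 / 4 := by norm_num
  have hmain := MatchingCompletion.assouad_bound (hr.trans hrN) hm hmr hNK hN2 hσ hγ0 hγ1
    (MatchingCompletion.one_add_mul_exp_sub_one_pow_le_two (by positivity) (by positivity)
      (hs.trans (by nlinarith [mul_nonneg hc₀pos.le hq0])) hinfo)
  have hw : 0 < √((N : ℝ) * K) := Real.sqrt_pos.2 (by positivity)
  -- `N` cancels here, which leaves the rate `K √(r / n)`.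
  have hwq : √((N : ℝ) * K) * q = K * √(r / n) := by
    rw [hq, ← Real.sqrt_mul (by positivity)]
    have : (N : ℝ) * K * (r * K / (n * N)) = K ^ 2 * (r / n) := by field_simp
    rw [this, Real.sqrt_mul (by positivity), Real.sqrt_sq hK'.le]
  have hval : (N : ℝ) * K * γ / 16 =
      √((N : ℝ) * K) * (c₀ / 16 * min σ 1 * (K * √(r / n))) := by
    rw [← hwq, hγ]
    nth_rewrite 1 [← Real.mul_self_sqrt (show 0 ≤ (N : ℝ) * K by positivity)]
    ring
  rw [hval, ENNReal.ofReal_mul hw.le] at hmain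
  exact (ENNReal.mul_le_mul_iff_right (ENNReal.ofReal_pos.2 hw).ne' ENNReal.ofReal_ne_top).1 hmain
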